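/- Let $(E,\mathcal E)$ be a measurable space and let $Q$ be a bounded positive kernel on it: $Q(x,\cdot)$ is a positive measure for every $x\in E$, $Q(\cdot,A)$ is measurable for every $A\in\mathcal E$, and $\sup_{x\in E}Q(x,E)<+\infty$. Let $\mathcal B$ be the Banach space of bounded measurable functions $f:E\to\mathbb C$ with the supremum norm, and consider $Q$ as the bounded operator on $\mathcal B$ given by $Qf(x)=\int_E f(y)\,Q(x,dy)$. Let $\mathcal M$ be the Banach space of bounded complex measures on $(E,\mathcal E)$ with the total variation norm. For a bounded operator $T$ on a complex Banach space $V$, let $\|T\|$ be its operator norm and $r(T)$ its spectral radius. Its essential spectral radius $r_e(T)$ is the infimum of $r(T)$ and of the real numbers $\rho\ge 0$ such that $V=F_\rho\oplus H_\rho$, where $F_\rho$ and $H_\rho$ are $T$-invariant subspaces, $H_\rho$ is closed, $r(T|_{H_\rho})<\rho$, $\dim F_\rho<+\infty$, and the eigenvalues of $T|_{F_\rho}$ have modulus $\ge\rho$. Then the formula $$(Q^*\mu)(A)=\int_E Q(x,A)\,d\mu(x),\qquad \mu\in\mathcal M,\ A\in\mathcal E,$$ defines a bounded linear operator $Q^*$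 on $\mathcal M$, and $$\|Q^*\|=\|Q\|,\qquad r(Q^*)=r(Q),\qquad r_e(Q^*)=r_e(Q).$$ -/

import Mathlib

open MeasureTheory ProbabilityTheory
open scoped ENNReal NNReal

noncomputable section

/-- The essential spectral radius of `T`: the infimum of `r(T)` and of the numbers `ρ ≥ 0` such that
`V = F ⊕ H` with `F`, `H` invariant under `T`, `H` closed, `r(T|H) < ρ`, `dim F < ∞`, and all
eigenvalues of `T|F` of modulus at least `ρ`. -/
def essentialSpectralRadius {V : Type*} [NormedAddCommGroup V] [NormedSpace ℂ V]
    (T : V →L[ℂ] V) : ℝ≥0∞ :=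
  sInf (insert (spectralRadius ℂ T)
    {r : ℝ≥0∞ | ∃ ρ : ℝ≥0, r = ρ ∧
      ∃ (F H : Submodule ℂ V) (hF : Set.MapsTo T F F) (hH : Set.MapsTo T H H),
        IsCompl F H ∧ IsClosed (H : Set V) ∧ spectralRadius ℂ (T.restrict hH) < ρ ∧
        FiniteDimensional ℂ F ∧
        ∀ z : ℂ, Module.End.HasEigenvalue (T.restrict hF).toLinearMap z → (ρ : ℝ) ≤ ‖z‖})

section

variable (E : Type*) [MeasurableSpace E]

/-- The space of bounded measurable complex valued functions on `E`, with the supremum norm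
(inherited from the space of all bounded functions). -/
def boundedMeasurable : Submodule ℂ (lp (fun _ : E => ℂ) ∞) where
  carrier := {f | Measurable (fun x => f x)}
  add_mem' hf hg := by
    exact Measurable.add hf hg
  zero_mem' := by
    simp [measurable_const]
  smul_mem' c f hf := by
    exact Measurable.const_smul hf c

end

section

variable {E : Type*} [MeasurableSpace E]

theorem isFiniteMeasure_variation_complexMeasure (μ : ComplexMeasure E) :
    IsFiniteMeasure μ.variation := by
  have hfin (s : SignedMeasure E) : IsFiniteMeasure s.variation := by
    rw [← SignedMeasure.totalVariation_eq_variation]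
    infer_instance
  have := hfin (ComplexMeasure.re μ)
  have := hfin (ComplexMeasure.im μ)
  refine isFiniteMeasure_of_le
    ((ComplexMeasure.re μ).variation + (ComplexMeasure.im μ).variation)
    (VectorMeasure.variation_le_of_forall_enorm_le fun A hA => ?_)
  have h : μ A = ((ComplexMeasure.re μ A : ℝ) : ℂ) + ((ComplexMeasure.im μ A : ℝ) : ℂ) * Complex.I :=
    (Complex.re_add_im (μ A)).symm
  rw [h]
  refine (enorm_add_le _ _).trans ?_
  rw [Measure.add_apply]
  refine add_le_add ?_ ?_
  · refine le_trans (le_of_eq ?_) (VectorMeasure.enorm_measure_le_variation _ A)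
    simp [enorm_eq_nnnorm]
  · refine le_trans (le_of_eq ?_) (VectorMeasure.enorm_measure_le_variation _ A)
    simp [enorm_eq_nnnorm]

/-- The norm of a complex measure is its total variation. -/
instance complexMeasureNorm : Norm (ComplexMeasure E) where
  norm μ := μ.variation.real Set.univ

theorem complexMeasureNormedSpaceCore : NormedSpace.Core ℂ (ComplexMeasure E) where
  norm_nonneg μ := measureReal_nonneg
  norm_smul c μ := by
    change (c • μ).variation.real Set.univ = ‖c‖ * μ.variation.real Set.univ
    simp [VectorMeasure.variation_smul, measureReal_def]
  norm_triangle μ ν := by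
    have := isFiniteMeasure_variation_complexMeasure μ
    have := isFiniteMeasure_variation_complexMeasure ν
    change (μ + ν).variation.real Set.univ ≤
      μ.variation.real Set.univ + ν.variation.real Set.univ
    rw [← measureReal_add_apply]
    exact ENNReal.toReal_mono (measure_ne_top _ _) (VectorMeasure.variation_add_le _)
  norm_eq_zero_iff μ := by
    have := isFiniteMeasure_variation_complexMeasure μ
    change μ.variation.real Set.univ = 0 ↔ μ = 0
    rw [measureReal_eq_zero_iff, Measure.measure_univ_eq_zero, VectorMeasure.variation_eq_zero]

instance complexMeasureNormedAddCommGroup : NormedAddCommGroup (ComplexMeasure E) :=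
  NormedAddCommGroup.ofCore complexMeasureNormedSpaceCore

instance complexMeasureNormedSpace : NormedSpace ℂ (ComplexMeasure E) :=
  NormedSpace.ofCore complexMeasureNormedSpaceCore

theorem integrable_boundedMeasurable (Q : Kernel E E) [IsFiniteKernel Q]
    (f : boundedMeasurable E) (x : E) : Integrable (fun y => f.1 y) (Q x) :=
  Integrable.of_bound (Measurable.aestronglyMeasurable f.2) ‖f‖
    (Filter.Eventually.of_forall fun y => lp.norm_apply_le_norm ENNReal.top_ne_zero f.1 y)

theorem norm_integral_kernel_le (Q : Kernel E E) [IsFiniteKernel Q]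
    (f : boundedMeasurable E) (x : E) :
    ‖∫ y, f.1 y ∂(Q x)‖ ≤ Q.bound.toReal * ‖f‖ := by
  refine (norm_integral_le_of_norm_le_const (C := ‖f‖) (Filter.Eventually.of_forall fun y =>
    lp.norm_apply_le_norm ENNReal.top_ne_zero f.1 y)).trans ?_
  rw [mul_comm]
  refine mul_le_mul_of_nonneg_right ?_ (norm_nonneg _)
  exact ENNReal.toReal_mono Q.bound_ne_top (Q.measure_le_bound x Set.univ)

/-- The operator `f ↦ Qf`, `Qf(x) = ∫ f(y) Q(x, dy)`, on the bounded measurable functions, for a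
bounded positive kernel `Q` (a kernel with `sup_x Q(x, E) < ∞`). -/
def kernelOperator (Q : Kernel E E) [IsFiniteKernel Q] :
    boundedMeasurable E →L[ℂ] boundedMeasurable E :=
  LinearMap.mkContinuous
    { toFun := fun f =>
        ⟨⟨fun x => ∫ y, f.1 y ∂(Q x), memℓp_infty
          ⟨Q.bound.toReal * ‖f‖, by
            rintro _ ⟨x, rfl⟩
            exact norm_integral_kernel_le Q f x⟩⟩,
          (StronglyMeasurable.integral_kernel (κ := Q)
            (Measurable.stronglyMeasurable f.2)).measurable⟩
      map_add' := fun f g => by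
        ext x
        exact integral_add (integrable_boundedMeasurable Q f x)
          (integrable_boundedMeasurable Q g x)
      map_smul' := fun c f => by
        ext x
        exact integral_const_mul c _ }
    Q.bound.toReal
    (fun f => lp.norm_le_of_forall_le (by positivity) fun x => norm_integral_kernel_le Q f x)

end

end

/-! The integration pairing embeds `ComplexMeasure E` isometrically in the dual of
`boundedMeasurable E`, and also embeds `boundedMeasurable E` isometrically in the dual of
`ComplexMeasure E`, Dirac masses recovering the supremum norm. Under it `Q` and `Q*` are adjoint to
each other. So each equality is two instances of one inequality: if `J : M → V*` is isometric and `J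
(S m) v = J m (T v)`, then `S` is dominated by `T`. For norms this is immediate; for spectral radii
it follows by applying it to powers and using Gelfand's formula.

For `essentialSpectralRadius`, a splitting `V = F ⊕ H` for `T` should give the splitting of `M` into
the annihilators of `H` and of `F`. Since `J` need not be onto, the difficulty is that the two
annihilators span `M`: with `p` the projection onto `F` along `H`, the functional `J m ∘ p` must
again come from `M`. This is `exists_dual_eq_comp_projection`. The range of `J` is closed and the
eigenvalues `μ` of `T` on `F` satisfy `|μ| ≥ ρ > r(T|H)`, so `μ⁻ⁿ Tⁿ` kills the `H` component in the
limit; nilpotent parts are handled by induction along generalized eigenspaces. -/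

/-! ### Spectral radii and finite-dimensional eigenvalue lemmas. -/

/-- Gelfand's formula: the constant disappears because its `n`-th root tends to 1. -/
theorem spectralRadius_le_of_norm_pow_le {A B : Type*} [NormedRing A] [NormedAlgebra ℂ A]
    [CompleteSpace A] [NormedRing B] [NormedAlgebra ℂ B] [CompleteSpace B] {a : A} {b : B} {C : ℝ}
    (h : ∀ n : ℕ, ‖a ^ n‖ ≤ C * ‖b ^ n‖) : spectralRadius ℂ a ≤ spectralRadius ℂ b := by
  -- The constant is replaced by a positive one, since `D ^ (1 / n) → 1` fails for `D = 0`.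
  obtain ⟨D, hD, hCD⟩ : ∃ D : ℝ≥0, 0 < D ∧ C ≤ D :=
    ⟨max 1 C.toNNReal, by positivity, (Real.le_coe_toNNReal C).trans (by simp)⟩
  have hlim : Filter.Tendsto (fun n : ℕ => ((D : ℝ≥0∞) ^ (1 / n : ℝ)) *
      (‖b ^ n‖₊ : ℝ≥0∞) ^ (1 / n : ℝ)) Filter.atTop (nhds (1 * spectralRadius ℂ b)) := by
    refine ENNReal.Tendsto.mul ?_ (Or.inl one_ne_zero)
      (spectrum.pow_nnnorm_pow_one_div_tendsto_nhds_spectralRadius b) (Or.inr ENNReal.one_ne_top)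
    have h1 : Filter.Tendsto (fun n : ℕ => D ^ (1 / n : ℝ)) Filter.atTop (nhds (D ^ (0 : ℝ))) :=
      tendsto_const_nhds.nnrpow tendsto_one_div_atTop_nhds_zero_nat (Or.inl hD.ne')
    rw [NNReal.rpow_zero] at h1
    have h2 := ENNReal.tendsto_coe.2 h1
    refine h2.congr fun n => ?_
    rw [ENNReal.coe_rpow_of_ne_zero hD.ne']
  rw [one_mul] at hlim
  refine le_of_tendsto_of_tendsto
    (spectrum.pow_nnnorm_pow_one_div_tendsto_nhds_spectralRadius a) hlim
    (Filter.Eventually.of_forall fun n => ?_)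
  dsimp only
  rw [← ENNReal.mul_rpow_of_nonneg _ _ (by positivity)]
  gcongr
  rw [← ENNReal.coe_mul, ENNReal.coe_le_coe, ← NNReal.coe_le_coe]
  push_cast
  exact (h n).trans (by gcongr)

theorem tendsto_norm_pow_div_pow_of_spectralRadius_lt {A : Type*} [NormedRing A]
    [NormedAlgebra ℂ A] [CompleteSpace A] {a : A} {ρ : ℝ≥0} (h : spectralRadius ℂ a < ρ) :
    Filter.Tendsto (fun n : ℕ => ‖a ^ n‖ / (ρ : ℝ) ^ n) Filter.atTop (nhds 0) := by
  obtain ⟨s, hs1, hs2⟩ := ENNReal.lt_iff_exists_nnreal_btwn.1 h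
  have hs2 : s < ρ := by exact_mod_cast hs2
  have hρ : 0 < ρ := zero_le.trans_lt hs2
  have hlt : Filter.Tendsto (fun n : ℕ => ((s : ℝ) / ρ) ^ n) Filter.atTop (nhds 0) :=
    tendsto_pow_atTop_nhds_zero_of_lt_one (by positivity)
      ((div_lt_one (by exact_mod_cast hρ)).2 (by exact_mod_cast hs2))
  refine squeeze_zero' (Filter.Eventually.of_forall fun n => by positivity) ?_ hlt
  have hev := (spectrum.pow_nnnorm_pow_one_div_tendsto_nhds_spectralRadius a).eventually_lt_const hs1
  filter_upwards [hev, Filter.eventually_ge_atTop 1] with n hn hn1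
  rw [div_pow]
  gcongr
  have hn0 : (n : ℝ) ≠ 0 := by positivity
  have h3 := ENNReal.rpow_le_rpow hn.le (Nat.cast_nonneg n)
  rw [← ENNReal.rpow_mul, one_div_mul_cancel hn0, ENNReal.rpow_one, ENNReal.rpow_natCast] at h3
  exact_mod_cast h3

/-- `P` is spanned by generalized eigenvectors of `G` restricted to `P`. Applying `G - μ` to one
lowers its order, so induction on the order reduces the claim to `hstep`. -/
theorem Submodule.le_of_forall_hasEigenvalue {K D : Type*} [Field K] [IsAlgClosed K]
    [AddCommGroup D] [Module K D] [FiniteDimensional K D] (G : Module.End K D)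
    {P U : Submodule K D} (hP : ∀ x ∈ P, G x ∈ P)
    (hstep : ∀ μ, G.HasEigenvalue μ → ∀ x ∈ P, G x - μ • x ∈ U → x ∈ U) : P ≤ U := by
  suffices h : (⊤ : Submodule K P) ≤ U.comap P.subtype from fun x hx => h (x := ⟨x, hx⟩) trivial
  rw [← Module.End.iSup_maxGenEigenspace_eq_top (LinearMap.restrict G hP)]
  refine iSup_le fun μ x hx => ?_
  obtain ⟨k, hk⟩ := (Module.End.mem_maxGenEigenspace _ _ _).1 hx
  clear hx
  induction k generalizing x with
  | zero =>
    have : x = 0 := by simpa using hk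
    simp [this]
  | succ k ih =>
    by_cases hx : x = 0
    · simp [hx]
    have hev : Module.End.HasEigenvalue (LinearMap.restrict G hP) μ := by
      refine Module.End.hasEigenvalue_of_hasGenEigenvalue (k := k + 1) fun hbot => hx ?_
      have : x ∈ Module.End.genEigenspace (LinearMap.restrict G hP) μ ((k + 1 : ℕ) : ℕ∞) :=
        Module.End.mem_genEigenspace_nat.2 hk
      rw [hbot] at this
      simpa using this
    obtain ⟨y, hy⟩ := hev.exists_hasEigenvector
    refine hstep μ (Module.End.hasEigenvalue_of_hasEigenvector (x := (y : D))
      ⟨Module.End.mem_eigenspace_iff.2 ?_, fun h0 => hy.2 (Subtype.ext h0)⟩) x x.2 ?_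
    · exact congrArg Subtype.val hy.apply_eq_smul
    · rw [pow_succ] at hk
      exact ih _ hk

/-- Otherwise `T - z` would be injective, hence surjective in finite dimension, while `φ` vanishes
on its range. -/
theorem Module.End.hasEigenvalue_of_dual_apply_eq {K F : Type*} [Field K]
    [AddCommGroup F] [Module K F] [FiniteDimensional K F] {T : Module.End K F} {z : K}
    {φ : Module.Dual K F} (hφ : φ ≠ 0) (h : ∀ x, φ (T x) = z * φ x) : T.HasEigenvalue z := by
  rw [Module.End.hasEigenvalue_iff]
  intro hbot
  rw [Module.End.eigenspace_def, LinearMap.ker_eq_bot, LinearMap.injective_iff_surjective] at hbot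
  refine hφ (LinearMap.ext fun x => ?_)
  obtain ⟨y, rfl⟩ := hbot x
  simp [h]

/-! ### Operators adjoint under an isometric pairing. -/

section Duality

variable {V M : Type*} [NormedAddCommGroup V] [NormedSpace ℂ V]
  [NormedAddCommGroup M] [NormedSpace ℂ M]
  {J : M →L[ℂ] StrongDual ℂ V} {S : M →L[ℂ] M} {T : V →L[ℂ] V}

theorem dual_apply_pow (hST : ∀ m v, J (S m) v = J m (T v)) (n : ℕ) (m : M) (v : V) :
    J ((S ^ n) m) v = J m ((T ^ n) v) := by
  induction n generalizing m with
  | zero => rfl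
  | succ n ih => rw [pow_succ S, pow_succ' T, mul_apply_eq_comp, ih, hST, ← mul_apply_eq_comp,
      ← pow_succ']

theorem opNorm_le_of_dual (hJ : ∀ m, ‖J m‖ = ‖m‖) (hST : ∀ m v, J (S m) v = J m (T v)) :
    ‖S‖ ≤ ‖T‖ := by
  refine S.opNorm_le_bound (norm_nonneg _) fun m => ?_
  rw [← hJ]
  refine ContinuousLinearMap.opNorm_le_bound _ (by positivity) fun v => ?_
  rw [hST]
  calc ‖J m (T v)‖ ≤ ‖J m‖ * ‖T v‖ := (J m).le_opNorm _
    _ ≤ ‖J m‖ * (‖T‖ * ‖v‖) := by gcongr; exact T.le_opNorm v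
    _ = ‖T‖ * ‖m‖ * ‖v‖ := by rw [hJ]; ring

theorem ContinuousLinearMap.coe_restrict_pow_apply {H : Submodule ℂ V}
    (hH : ∀ x ∈ H, T x ∈ H) (n : ℕ) (x : H) :
    (((T.restrict hH) ^ n) x : V) = (T ^ n) (x : V) := by
  induction n generalizing x with
  | zero => rfl
  | succ n ih => rw [pow_succ, pow_succ, mul_apply_eq_comp, ih]; rfl

theorem tendsto_norm_restrict_pow_div_pow {H : Submodule ℂ V} [CompleteSpace H] {ρ : ℝ≥0} (hH : ∀ x ∈ H, T x ∈ H)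
    (hr : spectralRadius ℂ (T.restrict hH) < ρ) (C : ℝ) :
    Filter.Tendsto (fun n : ℕ => C * (‖(T.restrict hH) ^ n‖ / (ρ : ℝ) ^ n))
      Filter.atTop (nhds 0) := by
  have hlim := tendsto_norm_pow_div_pow_of_spectralRadius_lt (A := H →L[ℂ] H)
    (a := T.restrict hH) hr
  have := hlim.const_mul C
  rwa [mul_zero] at this

variable [CompleteSpace V] [CompleteSpace M]

theorem spectralRadius_le_of_dual (hJ : ∀ m, ‖J m‖ = ‖m‖)
    (hST : ∀ m v, J (S m) v = J m (T v)) : spectralRadius ℂ S ≤ spectralRadius ℂ T :=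
  spectralRadius_le_of_norm_pow_le (C := 1) fun n => by
    rw [one_mul]
    exact opNorm_le_of_dual hJ (dual_apply_pow hST n)

variable {F H : Submodule ℂ V} {p : V →L[ℂ] F} {q : V →L[ℂ] H}

/-- The analytic core. In `hy`, `y n` represents the error made by replacing `Tⁿ` with `μⁿ` on the
`F` component. Removing it from `Sⁿ x` and dividing by `μⁿ` leaves `J x ∘ p` plus a term living on
`H`, which tends to 0. -/
theorem exists_dual_eq_comp_of_approx (hJ : ∀ m, ‖J m‖ = ‖m‖)
    (hST : ∀ m v, J (S m) v = J m (T v)) {ρ : ℝ≥0} (hH : ∀ x ∈ H, T x ∈ H)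
    (hpq : ∀ v, (p v : V) + q v = v) (hHc : IsClosed (H : Set V))
    (hr : spectralRadius ℂ (T.restrict hH) < ρ) {x : M} {y : ℕ → M} {μ : ℂ} (hμ : (ρ : ℝ) ≤ ‖μ‖)
    (hy : ∀ n v, J (y n) v = J x ((T ^ n) (p v)) - μ ^ n * J x (p v)) :
    ∃ m', ∀ v, J m' v = J x (p v) := by
  have hρ : (0 : ℝ) < ρ := by exact_mod_cast zero_le.trans_lt hr
  have hμ0 : μ ≠ 0 := norm_pos_iff.1 (hρ.trans_le hμ)
  have : CompleteSpace H := hHc.completeSpace_coe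
  have hiso : Isometry J := AddMonoidHomClass.isometry_of_norm J hJ
  have hclosed : IsClosed (Set.range J) := hiso.isClosedEmbedding.isClosed_range
  -- An isometry from a complete space has closed range, so approximation in norm is enough.
  suffices hg : (J x).comp (F.subtypeL.comp p) ∈ closure (Set.range J) by
    rw [hclosed.closure_eq] at hg
    obtain ⟨z, hz⟩ := hg
    exact ⟨z, fun v => by rw [hz]; rfl⟩
  refine mem_closure_of_tendsto (f := fun n => J ((μ ^ n)⁻¹ • ((S ^ n) x - y n)))
    (b := Filter.atTop) ?_ (Filter.Eventually.of_forall fun n => ⟨_, rfl⟩)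
  have hlim := tendsto_norm_restrict_pow_div_pow hH hr (‖J x‖ * ‖q‖)
  rw [tendsto_iff_norm_sub_tendsto_zero]
  refine squeeze_zero (fun n => norm_nonneg _) (fun n => ?_) hlim
  refine ContinuousLinearMap.opNorm_le_bound _ (by positivity) fun v => ?_
  have hkey : (J ((μ ^ n)⁻¹ • ((S ^ n) x - y n)) - (J x).comp (F.subtypeL.comp p)) v =
      (μ ^ n)⁻¹ * J x (((T.restrict hH) ^ n) (q v) : H) := by
    have h1 : J ((S ^ n) x) v = J x ((T ^ n) (p v)) + J x ((T ^ n) (q v)) := by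
      rw [dual_apply_pow hST, ← map_add, ← map_add, hpq]
    rw [ContinuousLinearMap.coe_restrict_pow_apply, map_smul, map_sub, sub_apply,
      smul_apply, sub_apply, h1, hy, smul_eq_mul]
    simp only [ContinuousLinearMap.comp_apply, Submodule.subtypeL_apply]
    field_simp
    ring
  rw [hkey, norm_mul, norm_inv, norm_pow]
  calc _ ≤ ((ρ : ℝ) ^ n)⁻¹ * (‖J x‖ * (‖(T.restrict hH) ^ n‖ * (‖q‖ * ‖v‖))) := by
        gcongr
        refine (ContinuousLinearMap.le_opNorm _ _).trans ?_
        gcongr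
        refine (ContinuousLinearMap.le_opNorm ((T.restrict hH) ^ n) _).trans ?_
        gcongr
        exact ContinuousLinearMap.le_opNorm _ _
    _ = _ := by ring

/-- A subspace of the dual that is invariant under the adjoint of `T` also contains the components
of its elements along a finite dimensional spectral subspace dominating its complement. -/
theorem exists_dual_eq_comp_projection (hJ : ∀ m, ‖J m‖ = ‖m‖)
    (hST : ∀ m v, J (S m) v = J m (T v)) {ρ : ℝ≥0} (hF : ∀ x ∈ F, T x ∈ F)
    (hH : ∀ x ∈ H, T x ∈ H) (hpq : ∀ v, (p v : V) + q v = v)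
    (hcomm : ∀ v, p (T v) = T.restrict hF (p v)) (hHc : IsClosed (H : Set V))
    (hr : spectralRadius ℂ (T.restrict hH) < ρ) [FiniteDimensional ℂ F]
    (hev : ∀ z : ℂ, Module.End.HasEigenvalue (T.restrict hF).toLinearMap z → (ρ : ℝ) ≤ ‖z‖)
    (m : M) : ∃ m', ∀ v, J m' v = J m (p v) := by
  let ψ : M →ₗ[ℂ] Module.Dual ℂ F :=
    { toFun := fun m => ((J m).comp F.subtypeL).toLinearMap
      map_add' := fun a b => by rw [map_add]; rfl
      map_smul' := fun c a => by rw [map_smul]; rfl }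
  -- The functionals on `F` whose extension by 0 on `H` comes from `M`; the goal is that every
  -- restriction `ψ m` lies in it.
  let U : Submodule ℂ (Module.Dual ℂ F) :=
    { carrier := {φ | ∃ m', ∀ v, J m' v = φ (p v)}
      add_mem' := by
        rintro a b ⟨x, hx⟩ ⟨y, hy⟩
        exact ⟨x + y, fun v => by rw [map_add, add_apply, hx, hy]; rfl⟩
      zero_mem' := ⟨0, fun v => by rw [map_zero]; rfl⟩
      smul_mem' := by
        rintro c a ⟨x, hx⟩
        exact ⟨c • x, fun v => by rw [map_smul, smul_apply, hx]; rfl⟩ }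
  let G : Module.End ℂ (Module.Dual ℂ F) := (T.restrict hF).toLinearMap.dualMap
  have hGU : ∀ φ ∈ U, G φ ∈ U := by
    rintro φ ⟨x, hx⟩
    refine ⟨S x, fun v => ?_⟩
    rw [hST, hx, hcomm]
    rfl
  have hGψ (x : M) : G (ψ x) = ψ (S x) := LinearMap.ext fun v => (hST x v).symm
  have hGnψ (n : ℕ) (x : M) : (G ^ n) (ψ x) = ψ ((S ^ n) x) := by
    induction n generalizing x with
    | zero => rfl
    | succ n ih =>
      rw [pow_succ, pow_succ, Module.End.mul_apply, hGψ, ih]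
      rfl
  have hle : LinearMap.range ψ ≤ U := by
    refine Submodule.le_of_forall_hasEigenvalue G ?_ ?_
    · rintro _ ⟨x, rfl⟩
      exact ⟨S x, (hGψ x).symm⟩
    rintro μ hμ _ ⟨x, rfl⟩ hxU
    have hμρ : (ρ : ℝ) ≤ ‖μ‖ := by
      obtain ⟨φ, hφ⟩ := hμ.exists_hasEigenvector
      refine hev μ (Module.End.hasEigenvalue_of_dual_apply_eq hφ.2 fun v => ?_)
      exact DFunLike.congr_fun hφ.apply_eq_smul v
    -- `U` is `G`-invariant, so modulo `U` the vector `ψ x` is an eigenvector and `Gⁿ` acts on it as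
    -- `μⁿ`.
    have hpow (n : ℕ) : (G ^ n) (ψ x) - μ ^ n • ψ x ∈ U := by
      induction n with
      | zero => simp
      | succ n ih =>
        have h1 := U.add_mem (hGU _ ih) (U.smul_mem (μ ^ n) hxU)
        convert h1 using 1
        rw [pow_succ' G, pow_succ μ, Module.End.mul_apply, map_sub, map_smul, smul_sub, smul_smul]
        abel
    choose y hy using hpow
    refine exists_dual_eq_comp_of_approx hJ hST hH hpq hHc hr (x := x) (y := y) hμρ fun n v => ?_
    rw [hy, hGnψ, ← dual_apply_pow hST]
    rfl
  exact hle ⟨m, rfl⟩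

/-- Functionals from `N` vanish on the invariant subspace `F`, so they see only `Tⁿ (q v)`. Hence
the powers of `S` on `N` are bounded by `‖q‖` times those of `T` on `H`. -/
theorem spectralRadius_restrict_le_of_dual (hJ : ∀ m, ‖J m‖ = ‖m‖)
    (hST : ∀ m v, J (S m) v = J m (T v)) (hH : ∀ x ∈ H, T x ∈ H)
    (hpq : ∀ v, (p v : V) + q v = v) (hF : ∀ x ∈ F, T x ∈ F) (hHc : IsClosed (H : Set V))
    {N : Submodule ℂ M} (hN : ∀ m ∈ N, S m ∈ N) (hNc : IsClosed (N : Set M))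
    (hNF : ∀ m ∈ N, ∀ v ∈ F, J m v = 0) :
    spectralRadius ℂ (S.restrict hN) ≤ spectralRadius ℂ (T.restrict hH) := by
  have : CompleteSpace H := hHc.completeSpace_coe
  have : CompleteSpace N := hNc.completeSpace_coe
  have hFn (n : ℕ) : ∀ x ∈ F, (T ^ n) x ∈ F := by
    induction n with
    | zero => exact fun x hx => hx
    | succ n ih => exact fun x hx => ih _ (hF x hx)
  refine spectralRadius_le_of_norm_pow_le (A := N →L[ℂ] N) (B := H →L[ℂ] H) (C := ‖q‖) fun n => ?_
  refine ContinuousLinearMap.opNorm_le_bound ((S.restrict hN) ^ n) (by positivity) fun m => ?_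
  rw [← Submodule.norm_coe, ContinuousLinearMap.coe_restrict_pow_apply, ← hJ]
  refine ContinuousLinearMap.opNorm_le_bound _ (by positivity) fun v => ?_
  have hkey : J ((S ^ n) m) v = J m (((T.restrict hH) ^ n) (q v) : H) := by
    rw [ContinuousLinearMap.coe_restrict_pow_apply, dual_apply_pow hST]
    conv_lhs => rw [← hpq v, map_add, map_add, hNF m m.2 _ (hFn n _ (p v).2), zero_add]
  rw [hkey]
  calc ‖J m (((T.restrict hH) ^ n) (q v) : H)‖
      ≤ ‖J m‖ * (‖(T.restrict hH) ^ n‖ * (‖q‖ * ‖v‖)) := by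
        refine (ContinuousLinearMap.le_opNorm _ _).trans ?_
        gcongr
        refine (ContinuousLinearMap.le_opNorm ((T.restrict hH) ^ n) _).trans ?_
        gcongr
        exact ContinuousLinearMap.le_opNorm _ _
    _ = _ := by rw [hJ, Submodule.norm_coe]; ring

theorem essentialSpectralRadius_le_of_dual (hJ : ∀ m, ‖J m‖ = ‖m‖)
    (hST : ∀ m v, J (S m) v = J m (T v)) :
    essentialSpectralRadius S ≤ essentialSpectralRadius T := by
  refine le_sInf fun r hr => ?_
  obtain rfl | ⟨ρ, rfl, F, H, hF, hH, hFH, hHc, hrad, hfin, hev⟩ := hr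
  · exact (sInf_le (Set.mem_insert _ _)).trans (spectralRadius_le_of_dual hJ hST)
  -- Both summands are closed, which makes the projections continuous.
  have htop : F.IsTopCompl H :=
    Submodule.IsCompl.isTopCompl_of_isClosed hFH F.closed_of_finiteDimensional hHc
  let p := F.projectionOntoL H htop
  let q := H.projectionOntoL F htop.symm
  have hpq (v : V) : (p v : V) + q v = v :=
    DFunLike.congr_fun (Submodule.projectionL_add_projectionL_eq_id htop) v
  have hcomm (v : V) : p (T v) = T.restrict hF (p v) := by
    have h1 : p (T (q v)) = 0 := Submodule.projectionOntoL_apply_eq_zero_of_mem_right htop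
      (hH (q v).2)
    have h2 : p (T (p v)) = T.restrict hF (p v) :=
      Submodule.projectionOntoL_apply_left htop (T.restrict hF (p v))
    conv_lhs => rw [← hpq v, map_add, map_add, h1, h2, add_zero]
  refine sInf_le (Or.inr ⟨ρ, rfl, ?_⟩)
  let annihilator (W : Submodule ℂ V) : Submodule ℂ M :=
    { carrier := {m | ∀ v ∈ W, J m v = 0}
      add_mem' := fun ha hb v hv => by
        rw [map_add, add_apply, ha v hv, hb v hv, add_zero]
      zero_mem' := fun v _ => by rw [map_zero]; rfl
      smul_mem' := fun c a ha v hv => by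
        rw [map_smul, smul_apply, ha v hv, smul_zero] }
  have hinv (W : Submodule ℂ V) (hW : Set.MapsTo T W W) :
      Set.MapsTo S (annihilator W) (annihilator W) := fun m hm v hv => by
    rw [hST]
    exact hm _ (hW hv)
  have hclosed (W : Submodule ℂ V) : IsClosed (annihilator W : Set M) := by
    have : (annihilator W : Set M) = ⋂ v ∈ W, {m | J m v = 0} := by
      ext m
      simp [annihilator]
    rw [this]
    exact isClosed_biInter fun v _ => isClosed_eq (by fun_prop) continuous_const
  have hinj {m : M} (hm : ∀ v, J m v = 0) : m = 0 := by
    rw [← norm_eq_zero, ← hJ, norm_eq_zero]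
    exact ContinuousLinearMap.ext hm
  -- The roles cross over: the annihilator of `H` embeds in the dual of `F` and is the
  -- finite-dimensional summand.
  refine ⟨annihilator H, annihilator F, hinv H hH, hinv F hF, ?_, hclosed F, ?_, ?_, ?_⟩
  · refine IsCompl.of_eq ?_ ?_
    · refine (Submodule.eq_bot_iff _).2 fun m hm => hinj fun v => ?_
      rw [← hpq v, map_add, hm.1 _ (q v).2, hm.2 _ (p v).2, add_zero]
    · refine Submodule.eq_top_iff'.2 fun m => ?_
      obtain ⟨m', hm'⟩ :=
        exists_dual_eq_comp_projection hJ hST hF hH hpq hcomm hHc hrad hev m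
      refine Submodule.mem_sup.2 ⟨m', fun v hv => ?_, m - m', fun v hv => ?_, by abel⟩
      · rw [hm', show p v = 0 from
          Submodule.projectionOntoL_apply_eq_zero_of_mem_right htop hv]
        exact map_zero _
      · rw [map_sub, sub_apply, hm', show p v = ⟨v, hv⟩ from
          Submodule.projectionOntoL_apply_left htop ⟨v, hv⟩, sub_self]
  · exact (spectralRadius_restrict_le_of_dual hJ hST hH hpq hF hHc (hinv F hF) (hclosed F)
      fun m hm => hm).trans_lt hrad
  · let ψ : annihilator H →ₗ[ℂ] Module.Dual ℂ F :=
      { toFun := fun m => ((J m).comp F.subtypeL).toLinearMap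
        map_add' := fun a b => by rw [Submodule.coe_add, map_add]; rfl
        map_smul' := fun c a => by rw [Submodule.coe_smul, map_smul]; rfl }
    refine FiniteDimensional.of_injective ψ ((injective_iff_map_eq_zero ψ).2 fun m hm => ?_)
    refine Subtype.ext (hinj fun v => ?_)
    rw [← hpq v, map_add, m.2 _ (q v).2, add_zero]
    exact DFunLike.congr_fun hm (p v)
  · intro z hz
    obtain ⟨m, hm⟩ := hz.exists_hasEigenvector
    have hSm : S m = z • (m : M) := congrArg Subtype.val hm.apply_eq_smul
    refine hev z (Module.End.hasEigenvalue_of_dual_apply_eq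
      (φ := ((J m).comp F.subtypeL).toLinearMap) (fun h0 => hm.2 (Subtype.ext (hinj fun v => ?_)))
      fun x => ?_)
    · rw [← hpq v, map_add, m.2 _ (q v).2, add_zero]
      exact DFunLike.congr_fun h0 (p v)
    · change J m (T x) = z * J m x
      rw [← hST, hSm, map_smul]
      rfl

end Duality

/-! ### The Banach space of bounded measurable functions. -/

section BoundedMeasurable

variable {E : Type*} [MeasurableSpace E]

namespace boundedMeasurable

instance : AddMonoidHomClass (StrongDual ℂ (boundedMeasurable E)) (boundedMeasurable E) ℂ where
  map_add L := ContinuousLinearMap.map_add L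
  map_zero L := ContinuousLinearMap.map_zero L

/-- A bounded measurable function as an element of the Banach space. -/
noncomputable def mk (f : E → ℂ) (hf : Measurable f) (C : ℝ) (hC : ∀ x, ‖f x‖ ≤ C) :
    boundedMeasurable E :=
  ⟨⟨f, memℓp_infty ⟨C, by rintro _ ⟨x, rfl⟩; exact hC x⟩⟩, hf⟩

protected theorem ext {f g : boundedMeasurable E} (h : ∀ x, f.1 x = g.1 x) : f = g :=
  Subtype.ext (lp.ext (funext h))

theorem norm_apply_le (f : boundedMeasurable E) (x : E) : ‖f.1 x‖ ≤ ‖f‖ :=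
  lp.norm_apply_le_norm ENNReal.top_ne_zero f.1 x

theorem norm_le_of_forall {f : boundedMeasurable E} {C : ℝ} (hC : 0 ≤ C)
    (h : ∀ x, ‖f.1 x‖ ≤ C) : ‖f‖ ≤ C :=
  lp.norm_le_of_forall_le hC h

/-- The indicator function of a measurable set. -/
noncomputable def indicator (A : Set E) (hA : MeasurableSet A) : boundedMeasurable E :=
  mk (A.indicator fun _ => 1) (measurable_const.indicator hA) 1 fun x => by
    by_cases hx : x ∈ A <;> simp [hx]

theorem indicator_apply (A : Set E) (hA : MeasurableSet A) (x : E) :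
    (indicator A hA).1 x = A.indicator (fun _ => 1) x := rfl

theorem norm_indicator_le (A : Set E) (hA : MeasurableSet A) : ‖indicator A hA‖ ≤ 1 :=
  norm_le_of_forall zero_le_one fun x => by
    rw [indicator_apply]
    by_cases hx : x ∈ A <;> simp [hx]

theorem sum_apply {ι : Type*} (s : Finset ι) (f : ι → boundedMeasurable E) (x : E) :
    (∑ i ∈ s, f i).1 x = ∑ i ∈ s, (f i).1 x :=
  map_sum ({ toFun := fun f => f.1 x, map_zero' := rfl, map_add' := fun _ _ => rfl } :
    boundedMeasurable E →+ ℂ) f s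

instance : CompleteSpace (boundedMeasurable E) := by
  suffices h : IsClosed (boundedMeasurable E : Set (lp (fun _ : E => ℂ) ∞)) from
    h.completeSpace_coe
  refine IsSeqClosed.isClosed fun u f hu hf => ?_
  refine measurable_of_tendsto_metrizable (f := fun n x => u n x) hu (tendsto_pi_nhds.2 fun x => ?_)
  rw [tendsto_iff_norm_sub_tendsto_zero] at hf ⊢
  exact squeeze_zero (fun n => norm_nonneg _)
    (fun n => lp.norm_apply_le_norm ENNReal.top_ne_zero (u n - f) x) hf

/-- The values of `f` lie in a compact ball, covered by finitely many `ε`-balls around points of a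
dense sequence; each value is rounded to a nearest point among an initial segment containing these
centres. -/
theorem exists_simpleFunc_dist_le (f : boundedMeasurable E) {ε : ℝ} (hε : 0 < ε) :
    ∃ s : SimpleFunc E ℂ, ∀ x, ‖f.1 x - s x‖ ≤ ε := by
  let e := TopologicalSpace.denseSeq ℂ
  obtain ⟨t, ht⟩ := (isCompact_closedBall (0 : ℂ) ‖f‖).elim_finite_subcover
    (fun k => Metric.ball (e k) ε) (fun k => Metric.isOpen_ball) fun z _ => by
      obtain ⟨k, hk⟩ := (TopologicalSpace.denseRange_denseSeq ℂ).exists_dist_lt z hε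
      exact Set.mem_iUnion.2 ⟨k, hk⟩
  refine ⟨(SimpleFunc.nearestPt e (t.sup id)).comp _ f.2, fun x => ?_⟩
  have hx := ht (mem_closedBall_zero_iff.2 (norm_apply_le f x))
  simp only [Set.mem_iUnion] at hx
  obtain ⟨k, hk, hkx⟩ := hx
  have h1 := SimpleFunc.edist_nearestPt_le e (f.1 x) (Finset.le_sup (f := id) hk)
  rw [edist_dist, edist_dist, ENNReal.ofReal_le_ofReal_iff dist_nonneg] at h1
  rw [← dist_eq_norm, dist_comm]
  refine h1.trans ?_
  rw [dist_comm]
  exact hkx.le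

/-- Continuous functionals are determined by their values on indicator functions. -/
theorem dual_ext {L L' : StrongDual ℂ (boundedMeasurable E)}
    (h : ∀ A hA, L (indicator A hA) = L' (indicator A hA)) : L = L' := by
  have hsimple (s : SimpleFunc E ℂ) : ∀ g : boundedMeasurable E, (∀ x, g.1 x = s x) →
      L g = L' g := by
    induction s using SimpleFunc.induction with
    | const c hA =>
      intro g hg
      have : g = c • indicator _ hA := boundedMeasurable.ext fun x => by
        rw [hg]
        change _ = c * _
        rw [indicator_apply]
        simp [Set.indicator, Set.piecewise]
      rw [this, map_smul, map_smul, h]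
    | add hdisj h₁ h₂ =>
      rename_i s₁ s₂
      intro g hg
      obtain ⟨C₁, hC₁⟩ := s₁.exists_forall_norm_le
      obtain ⟨C₂, hC₂⟩ := s₂.exists_forall_norm_le
      have : g = mk s₁ s₁.measurable C₁ hC₁ + mk s₂ s₂.measurable C₂ hC₂ :=
        boundedMeasurable.ext fun x => hg x
      rw [this, map_add, map_add, h₁ _ fun x => rfl, h₂ _ fun x => rfl]
  refine ContinuousLinearMap.ext fun f => eq_of_forall_dist_le fun ε hε => ?_
  have hpos : 0 < ‖L - L'‖ + 1 := by positivity
  obtain ⟨s, hs⟩ := exists_simpleFunc_dist_le f (div_pos hε hpos)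
  obtain ⟨C, hC⟩ := s.exists_forall_norm_le
  let g := mk s s.measurable C hC
  have hfg : ‖f - g‖ ≤ ε / (‖L - L'‖ + 1) := norm_le_of_forall (by positivity) hs
  have heq : L f - L' f = (L - L') (f - g) := by
    rw [(L - L').map_sub, sub_apply, sub_apply, hsimple s g fun x => rfl]
    ring
  rw [dist_eq_norm, heq]
  calc ‖(L - L') (f - g)‖ ≤ ‖L - L'‖ * (ε / (‖L - L'‖ + 1)) :=
        (ContinuousLinearMap.le_opNorm _ _).trans (by gcongr)
    _ ≤ (‖L - L'‖ + 1) * (ε / (‖L - L'‖ + 1)) := by gcongr; linarith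
    _ = ε := mul_div_cancel₀ _ hpos.ne'

end boundedMeasurable

end BoundedMeasurable

/-! ### The pairing of complex measures with bounded measurable functions. -/

section Pairing

variable {E : Type*} [MeasurableSpace E]

instance (μ : ComplexMeasure E) : IsFiniteMeasure μ.variation :=
  isFiniteMeasure_variation_complexMeasure μ

namespace MeasureTheory.ComplexMeasure

theorem norm_def (μ : ComplexMeasure E) : ‖μ‖ = μ.variation.real Set.univ := rfl

theorem norm_apply_le (μ : ComplexMeasure E) (A : Set E) : ‖μ A‖ ≤ ‖μ‖ := by
  refine (VectorMeasure.norm_measure_le_variation (measure_ne_top _ _)).trans ?_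
  exact measureReal_mono (Set.subset_univ A)

theorem norm_le_of_forall_sum_le {μ : ComplexMeasure E} {C : ℝ} (hC : 0 ≤ C)
    (h : ∀ P : Finset (Set E), (P : Set (Set E)).PairwiseDisjoint id →
      (∀ t ∈ P, MeasurableSet t) → ∑ p ∈ P, ‖μ p‖ ≤ C) : ‖μ‖ ≤ C := by
  refine ENNReal.toReal_le_of_le_ofReal hC (le_of_forall_lt fun a ha => ?_)
  obtain ⟨P, -, hd, hm, hlt⟩ := VectorMeasure.exists_lt_sum_of_lt_variation μ .univ ha
  refine hlt.trans_le ?_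
  have : ∑ p ∈ P, ‖μ p‖ₑ = ENNReal.ofReal (∑ p ∈ P, ‖μ p‖) := by
    rw [ENNReal.ofReal_sum_of_nonneg fun _ _ => norm_nonneg _]
    simp
  rw [this]
  exact ENNReal.ofReal_le_ofReal (h P hd hm)

theorem sum_norm_le (μ : ComplexMeasure E) {P : Finset (Set E)}
    (hd : (P : Set (Set E)).PairwiseDisjoint id) : ∑ p ∈ P, ‖μ p‖ ≤ ‖μ‖ := by
  have h1 := VectorMeasure.le_variation μ .univ (P := P) (fun _ _ => Set.subset_univ _) hd
  have h2 := ENNReal.toReal_mono (measure_ne_top _ _) h1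
  rw [ENNReal.toReal_sum fun _ _ => enorm_ne_top] at h2
  simpa [norm_def, measureReal_def] using h2

theorem integrable_boundedMeasurable (μ : ComplexMeasure E) (f : boundedMeasurable E) :
    μ.Integrable fun x => f.1 x :=
  Integrable.of_bound (Measurable.aestronglyMeasurable f.2) ‖f‖
    (Filter.Eventually.of_forall (boundedMeasurable.norm_apply_le f))

/-- Integration of bounded measurable functions against a complex measure. -/
noncomputable def integralFunctional (μ : ComplexMeasure E) : StrongDual ℂ (boundedMeasurable E) :=
  LinearMap.mkContinuous
    { toFun := fun f => ∫ᵛ x, f.1 x ∂[ContinuousLinearMap.mul ℝ ℂ; μ]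
      map_add' := fun f g => VectorMeasure.integral_fun_add
        (integrable_boundedMeasurable μ f) (integrable_boundedMeasurable μ g)
      map_smul' := fun c f => setToFun_smul _ (fun c s x => mul_assoc c x (μ s)) c _ }
    ‖μ‖
    (fun f => by
      refine (VectorMeasure.norm_integral_le_of_norm_le_const
        (Filter.Eventually.of_forall (boundedMeasurable.norm_apply_le f))).trans ?_
      have h1 : ‖ContinuousLinearMap.mul ℝ ℂ‖ ≤ 1 := ContinuousLinearMap.opNorm_mul_le ℝ ℂ
      calc _ ≤ ‖f‖ * 1 * ‖μ‖ := by rw [norm_def]; gcongr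
        _ = ‖μ‖ * ‖f‖ := by ring)

theorem integralFunctional_apply (μ : ComplexMeasure E) (f : boundedMeasurable E) :
    integralFunctional μ f = ∫ᵛ x, f.1 x ∂[ContinuousLinearMap.mul ℝ ℂ; μ] := rfl

theorem norm_integralFunctional_le (μ : ComplexMeasure E) : ‖integralFunctional μ‖ ≤ ‖μ‖ :=
  LinearMap.mkContinuous_norm_le _ (norm_nonneg _) _

theorem integralFunctional_indicator (μ : ComplexMeasure E) (A : Set E) (hA : MeasurableSet A) :
    integralFunctional μ (boundedMeasurable.indicator A hA) = μ A := by
  rw [integralFunctional_apply]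
  simp only [boundedMeasurable.indicator_apply]
  rw [VectorMeasure.integral_indicator_const _ hA]
  simp

theorem integralFunctional_eq_integral_smul (μ : ComplexMeasure E) {g : E → ℝ}
    (f : boundedMeasurable E) (hfg : ∀ x, f.1 x = g x) :
    integralFunctional μ f = ∫ᵛ x, g x ∂•μ := by
  have hg : Integrable g μ.variation := by
    have := (integrable_boundedMeasurable μ f).re
    simpa [hfg] using this
  rw [integralFunctional_apply]
  simp only [hfg]
  refine (VectorMeasure.integral_continuousLinearMap_comp (C := Complex.ofRealCLM) hg).trans ?_
  congr 1

theorem tendsto_integralFunctional (μ : ComplexMeasure E) {ι : Type*} {l : Filter ι}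
    [l.IsCountablyGenerated] {u : ι → boundedMeasurable E} {f : boundedMeasurable E} {C : ℝ}
    (hC : ∀ i, ‖u i‖ ≤ C) (h : ∀ x, Filter.Tendsto (fun i => (u i).1 x) l (nhds (f.1 x))) :
    Filter.Tendsto (fun i => integralFunctional μ (u i)) l (nhds (integralFunctional μ f)) := by
  refine tendsto_setToFun_filter_of_norm_le_const _
    (Filter.Eventually.of_forall fun i => Measurable.aestronglyMeasurable (u i).2)
    ⟨C, Filter.Eventually.of_forall fun i => Filter.Eventually.of_forall fun x =>
      (boundedMeasurable.norm_apply_le (u i) x).trans (hC i)⟩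
    (Filter.Eventually.of_forall h)

/-- For finitely many disjoint sets `p`, test against the function equal on each `p` to the phase
that turns `μ p` into `‖μ p‖`. Its norm is at most 1 and its integral is `∑ ‖μ p‖`. -/
theorem norm_le_norm_integralFunctional (μ : ComplexMeasure E) : ‖μ‖ ≤ ‖integralFunctional μ‖ := by
  refine norm_le_of_forall_sum_le (ContinuousLinearMap.opNorm_nonneg _) fun P hd hm => ?_
  have hphase (z : ℂ) : ∃ u : ℂ, ‖u‖ ≤ 1 ∧ u * z = ‖z‖ := by
    by_cases hz : z = 0
    · exact ⟨0, by simp, by simp [hz]⟩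
    · refine ⟨‖z‖ / z, by simp [hz], by field_simp⟩
  choose u hu1 hu2 using hphase
  let f : boundedMeasurable E := ∑ p ∈ P.attach, u (μ p) • boundedMeasurable.indicator p.1 (hm _ p.2)
  have hfapp (x : E) : f.1 x = ∑ p ∈ P, u (μ p) * p.indicator (fun _ => 1) x := by
    rw [← Finset.sum_attach P]
    exact boundedMeasurable.sum_apply _ _ _
  have hf : ‖f‖ ≤ 1 := boundedMeasurable.norm_le_of_forall zero_le_one fun x => by
    rw [hfapp]
    by_cases hx : ∃ p ∈ P, x ∈ p
    · obtain ⟨p, hp, hxp⟩ := hx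
      rw [Finset.sum_eq_single_of_mem p hp fun r hr hrp => ?_]
      · simpa [hxp] using hu1 _
      · have : x ∉ r := fun hxr => Set.disjoint_left.1 (hd hr hp hrp) hxr hxp
        simp [this]
    · rw [Finset.sum_eq_zero fun r hr => ?_]
      · simp
      · have : x ∉ r := fun hxr => hx ⟨r, hr, hxr⟩
        simp [this]
  have hval : integralFunctional μ f = ((∑ p ∈ P, ‖μ p‖ : ℝ) : ℂ) := by
    rw [map_sum (integralFunctional μ), ← Finset.sum_attach P, Complex.ofReal_sum]
    refine Finset.sum_congr rfl fun p _ => ?_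
    rw [(integralFunctional μ).map_smul, integralFunctional_indicator, smul_eq_mul, hu2]
  have h1 := (integralFunctional μ).le_opNorm f
  rw [hval, Complex.norm_real, Real.norm_of_nonneg (Finset.sum_nonneg fun _ _ => norm_nonneg _)] at h1
  exact h1.trans (mul_le_of_le_one_right (ContinuousLinearMap.opNorm_nonneg _) hf)

theorem norm_integralFunctional (μ : ComplexMeasure E) : ‖integralFunctional μ‖ = ‖μ‖ :=
  (norm_integralFunctional_le μ).antisymm (norm_le_norm_integralFunctional μ)

variable (E) in
/-- The isometric embedding of complex measures in the dual of the bounded measurable functions. -/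
noncomputable def toDual : ComplexMeasure E →L[ℂ] StrongDual ℂ (boundedMeasurable E) :=
  LinearMap.mkContinuous
    { toFun := integralFunctional
      map_add' := fun μ ν => boundedMeasurable.dual_ext fun A hA => by
        simp only [add_apply, integralFunctional_indicator]
      map_smul' := fun c μ => boundedMeasurable.dual_ext fun A hA => by
        simp only [smul_apply, integralFunctional_indicator, RingHom.id_apply] }
    1 (fun μ => by simpa using norm_integralFunctional_le μ)

theorem toDual_apply (μ : ComplexMeasure E) : toDual E μ = integralFunctional μ := rfl

theorem norm_toDual_apply (μ : ComplexMeasure E) : ‖toDual E μ‖ = ‖μ‖ := norm_integralFunctional μ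

/-- Dirac masses have norm at most 1 and evaluate `f` at points. This isometry lets the duality
inequalities be used in the reverse direction. -/
theorem norm_toDual_flip_apply (f : boundedMeasurable E) : ‖(toDual E).flip f‖ = ‖f‖ := by
  refine le_antisymm ?_ ?_
  · refine ContinuousLinearMap.opNorm_le_bound _ (norm_nonneg _) fun μ => ?_
    rw [ContinuousLinearMap.flip_apply, mul_comm, ← norm_toDual_apply]
    exact ContinuousLinearMap.le_opNorm _ _
  · refine boundedMeasurable.norm_le_of_forall (norm_nonneg _) fun x => ?_
    let δ : ComplexMeasure E := VectorMeasure.dirac x (1 : ℂ)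
    have hδ : ‖δ‖ ≤ 1 := by
      rw [norm_def, VectorMeasure.variation_dirac]
      simp [measureReal_def]
    have hval : (toDual E).flip f δ = f.1 x := by
      rw [ContinuousLinearMap.flip_apply, toDual_apply, integralFunctional_apply,
        VectorMeasure.integral_dirac' (Measurable.stronglyMeasurable f.2)]
      simp
    rw [← hval]
    exact (ContinuousLinearMap.le_opNorm _ _).trans (mul_le_of_le_one_right (norm_nonneg _) hδ)

end MeasureTheory.ComplexMeasure

end Pairing

/-! ### Completeness of the space of measures, and the operator `Q*`. -/

section Adjoint

variable {E : Type*} [MeasurableSpace E]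

namespace MeasureTheory.ComplexMeasure

/-- As `‖μ A‖ ≤ ‖μ‖`, the setwise convergence is uniform in `A`, so the limit in `n` may be
exchanged with the limit of partial sums in countable additivity. -/
theorem exists_tendsto_of_cauchySeq {u : ℕ → ComplexMeasure E} (hu : CauchySeq u) :
    ∃ μ : ComplexMeasure E, ∀ A, Filter.Tendsto (fun n => u n A) Filter.atTop (nhds (μ A)) := by
  have hC (A : Set E) : ∃ z, Filter.Tendsto (fun n => u n A) Filter.atTop (nhds z) := by
    refine cauchySeq_tendsto_of_complete (Metric.cauchySeq_iff.2 fun ε hε => ?_)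
    obtain ⟨N, hN⟩ := Metric.cauchySeq_iff.1 hu ε hε
    refine ⟨N, fun m hm n hn => lt_of_le_of_lt ?_ (hN m hm n hn)⟩
    rw [dist_eq_norm, dist_eq_norm]
    exact norm_apply_le (u m - u n) A
  choose v hv using hC
  have hunif : TendstoUniformly (fun n A => u n A) v Filter.atTop := by
    refine Metric.tendstoUniformly_iff.2 fun ε hε => ?_
    obtain ⟨N, hN⟩ := Metric.cauchySeq_iff.1 hu (ε / 2) (half_pos hε)
    filter_upwards [Filter.eventually_ge_atTop N] with n hn A
    refine lt_of_le_of_lt ?_ (half_lt_self hε)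
    refine le_of_tendsto ((hv A).dist tendsto_const_nhds) ?_
    filter_upwards [Filter.eventually_ge_atTop N] with m hm
    refine le_trans ?_ (hN m hm n hn).le
    rw [dist_eq_norm, dist_eq_norm]
    exact norm_apply_le (u m - u n) A
  refine ⟨⟨v, ?_, fun A hA => ?_, fun A hA hd => ?_⟩, hv⟩
  · exact tendsto_nhds_unique (hv ∅) (by simp)
  · exact tendsto_nhds_unique (hv A) (by simp [VectorMeasure.not_measurable _ hA])
  · have hsum (s : Finset ℕ) : ∑ i ∈ s, v (A i) = v (⋃ i ∈ s, A i) := by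
      refine tendsto_nhds_unique (tendsto_finsetSum s fun i _ => hv (A i)) ?_
      simpa only [VectorMeasure.of_biUnion_finset (hd.set_pairwise _) fun i _ => hA i] using
        hv (⋃ i ∈ s, A i)
    have h1 := hunif.comp (fun s : Finset ℕ => ⋃ i ∈ s, A i)
    have h2 := h1.tendsto_of_eventually_tendsto (p' := Filter.atTop)
      (L := fun n => u n (⋃ i, A i)) (Filter.Eventually.of_forall fun n => ?_) (hv _)
    · refine h2.congr fun s => ?_
      exact (hsum s).symm
    · refine ((u n).m_iUnion hA hd).congr fun s => ?_
      exact (VectorMeasure.of_biUnion_finset (hd.set_pairwise _) fun i _ => hA i).symm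

instance : CompleteSpace (ComplexMeasure E) := by
  refine Metric.complete_of_cauchySeq_tendsto fun u hu => ?_
  obtain ⟨μ, hμ⟩ := exists_tendsto_of_cauchySeq hu
  refine ⟨μ, Metric.tendsto_atTop.2 fun ε hε => ?_⟩
  obtain ⟨N, hN⟩ := Metric.cauchySeq_iff.1 hu (ε / 2) (half_pos hε)
  refine ⟨N, fun n hn => lt_of_le_of_lt ?_ (half_lt_self hε)⟩
  rw [dist_eq_norm]
  -- Setwise limits pass through the finite sums defining the variation, which upgrades them to
  -- convergence in norm.
  refine norm_le_of_forall_sum_le (half_pos hε).le fun P hd hm => ?_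
  have hlim : Filter.Tendsto (fun m => ∑ p ∈ P, ‖(u n - u m) p‖) Filter.atTop
      (nhds (∑ p ∈ P, ‖(u n - μ) p‖)) :=
    tendsto_finsetSum P fun p _ => (tendsto_const_nhds.sub (hμ p)).norm
  refine le_of_tendsto hlim ?_
  filter_upwards [Filter.eventually_ge_atTop N] with m hm
  refine (sum_norm_le _ hd).trans ?_
  rw [← dist_eq_norm]
  exact (hN n hn m hm).le

variable (Q : Kernel E E) [IsFiniteKernel Q]

theorem _root_.kernelOperator_apply (f : boundedMeasurable E) (x : E) :
    (kernelOperator Q f).1 x = ∫ y, f.1 y ∂(Q x) := rfl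

theorem _root_.kernelOperator_indicator_apply (A : Set E) (hA : MeasurableSet A) (x : E) :
    (kernelOperator Q (boundedMeasurable.indicator A hA)).1 x = ((Q x).real A : ℂ) := by
  rw [kernelOperator_apply]
  simp only [boundedMeasurable.indicator_apply]
  rw [integral_indicator_const _ hA]
  simp

/-- Integration of `Qf` against a complex measure, as a functional of `f`. -/
noncomputable def kernelFunctional (μ : ComplexMeasure E) : StrongDual ℂ (boundedMeasurable E) :=
  (integralFunctional μ).comp (kernelOperator Q)

theorem kernelFunctional_apply (μ : ComplexMeasure E) (f : boundedMeasurable E) :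
    kernelFunctional Q μ f = integralFunctional μ (kernelOperator Q f) := rfl

/-- Continuity from below of each `Q x` gives pointwise convergence; dominated convergence for `μ`
does the rest. This yields the countable additivity of `bindKernel`. -/
theorem tendsto_kernelFunctional_indicator (μ : ComplexMeasure E) {A : ℕ → Set E}
    (hA : ∀ i, MeasurableSet (A i)) :
    Filter.Tendsto (fun s : Finset ℕ => kernelFunctional Q μ (boundedMeasurable.indicator
      (⋃ i ∈ s, A i) (s.measurableSet_biUnion fun i _ => hA i))) Filter.atTop
      (nhds (kernelFunctional Q μ (boundedMeasurable.indicator (⋃ i, A i) (.iUnion hA)))) := by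
  have hlim (x : E) : Filter.Tendsto (fun s : Finset ℕ => (kernelOperator Q
      (boundedMeasurable.indicator (⋃ i ∈ s, A i) (s.measurableSet_biUnion fun i _ => hA i))).1 x)
      Filter.atTop
      (nhds ((kernelOperator Q (boundedMeasurable.indicator (⋃ i, A i) (.iUnion hA))).1 x)) := by
    simp only [kernelOperator_indicator_apply]
    refine (Complex.continuous_ofReal.tendsto _).comp ?_
    refine (ENNReal.tendsto_toReal (measure_ne_top _ _)).comp ?_
    rw [Set.iUnion_eq_iUnion_finset A]
    exact tendsto_measure_iUnion_atTop fun s t hst => Set.biUnion_subset_biUnion_left hst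
  refine tendsto_integralFunctional μ (C := ‖kernelOperator Q‖) (fun s => ?_) hlim
  refine ((kernelOperator Q).le_opNorm _).trans ?_
  exact mul_le_of_le_one_right (ContinuousLinearMap.opNorm_nonneg _)
    (boundedMeasurable.norm_indicator_le _ _)

theorem kernelFunctional_indicator_biUnion (μ : ComplexMeasure E) {A : ℕ → Set E}
    (hA : ∀ i, MeasurableSet (A i)) (hd : Pairwise (Function.onFun Disjoint A)) (s : Finset ℕ) :
    kernelFunctional Q μ (boundedMeasurable.indicator (⋃ i ∈ s, A i)
      (s.measurableSet_biUnion fun i _ => hA i)) =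
    ∑ i ∈ s, kernelFunctional Q μ (boundedMeasurable.indicator (A i) (hA i)) := by
  rw [← map_sum (kernelFunctional Q μ)]
  congr 1
  refine boundedMeasurable.ext fun x => ?_
  rw [boundedMeasurable.sum_apply, boundedMeasurable.indicator_apply,
    Finset.indicator_biUnion s A (hd.set_pairwise _)]
  rfl

open Classical in
/-- The action of a kernel on complex measures. -/
noncomputable def bindKernel (μ : ComplexMeasure E) : ComplexMeasure E where
  measureOf' A := if hA : MeasurableSet A then
    kernelFunctional Q μ (boundedMeasurable.indicator A hA) else 0
  empty' := by
    have : boundedMeasurable.indicator (∅ : Set E) .empty = 0 :=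
      boundedMeasurable.ext fun x => by
        rw [boundedMeasurable.indicator_apply, Set.indicator_empty]
        rfl
    rw [dif_pos .empty, this, (kernelFunctional Q μ).map_zero]
  not_measurable' A hA := dif_neg hA
  m_iUnion' A hA hd := by
    rw [dif_pos (MeasurableSet.iUnion hA)]
    simp only [dif_pos (hA _)]
    refine (tendsto_kernelFunctional_indicator Q μ hA).congr fun s => ?_
    exact kernelFunctional_indicator_biUnion Q μ hA hd s

theorem bindKernel_apply (μ : ComplexMeasure E) (A : Set E) (hA : MeasurableSet A) :
    bindKernel Q μ A = kernelFunctional Q μ (boundedMeasurable.indicator A hA) :=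
  dif_pos hA

theorem integralFunctional_bindKernel (μ : ComplexMeasure E) :
    integralFunctional (bindKernel Q μ) = kernelFunctional Q μ :=
  boundedMeasurable.dual_ext fun A hA => by
    rw [integralFunctional_indicator, bindKernel_apply]

/-- The operator `Q*` of a bounded positive kernel `Q` on the complex measures. -/
noncomputable def adjointOperator : ComplexMeasure E →L[ℂ] ComplexMeasure E :=
  LinearMap.mkContinuous
    { toFun := bindKernel Q
      map_add' := fun μ ν => VectorMeasure.ext fun A hA => by
        rw [add_apply, bindKernel_apply Q _ A hA, bindKernel_apply Q _ A hA,
          bindKernel_apply Q _ A hA, kernelFunctional_apply, ← toDual_apply, (toDual E).map_add]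
        rfl
      map_smul' := fun c μ => VectorMeasure.ext fun A hA => by
        rw [smul_apply, bindKernel_apply Q _ A hA, bindKernel_apply Q _ A hA,
          kernelFunctional_apply, ← toDual_apply, (toDual E).map_smul]
        rfl }
    ‖kernelOperator Q‖
    (fun μ => by
      change ‖bindKernel Q μ‖ ≤ _
      rw [← norm_integralFunctional, integralFunctional_bindKernel, mul_comm,
        ← norm_integralFunctional μ]
      exact ContinuousLinearMap.opNorm_comp_le _ _)

theorem toDual_adjointOperator (μ : ComplexMeasure E) (f : boundedMeasurable E) :
    toDual E (adjointOperator Q μ) f = toDual E μ (kernelOperator Q f) :=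
  DFunLike.congr_fun (integralFunctional_bindKernel Q μ) f

theorem adjointOperator_apply (μ : ComplexMeasure E) (A : Set E) (hA : MeasurableSet A) :
    adjointOperator Q μ A = ∫ᵛ x, (Q x).real A ∂•μ :=
  (bindKernel_apply Q μ A hA).trans
    (integralFunctional_eq_integral_smul μ _ (kernelOperator_indicator_apply Q A hA))

end MeasureTheory.ComplexMeasure

end Adjoint

open MeasureTheory.ComplexMeasure in
theorem mainTheorem10 {E : Type*} [MeasurableSpace E] (Q : Kernel E E) [IsFiniteKernel Q] :
    ∃ Qstar : ComplexMeasure E →L[ℂ] ComplexMeasure E,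
      (∀ (μ : ComplexMeasure E) (A : Set E), MeasurableSet A →
        Qstar μ A = ∫ᵛ x, (Q x).real A ∂•μ) ∧
      ‖Qstar‖ = ‖kernelOperator Q‖ ∧
      spectralRadius ℂ Qstar = spectralRadius ℂ (kernelOperator Q) ∧
      essentialSpectralRadius Qstar = essentialSpectralRadius (kernelOperator Q) := by
  -- The same adjoint relation read with functions and measures exchanged, for the reverse
  -- inequalities.
  have hflip (f : boundedMeasurable E) (μ : ComplexMeasure E) :
      (toDual E).flip (kernelOperator Q f) μ = (toDual E).flip f (adjointOperator Q μ) :=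
    (toDual_adjointOperator Q μ f).symm
  refine ⟨adjointOperator Q, adjointOperator_apply Q, le_antisymm ?_ ?_, le_antisymm ?_ ?_,
    le_antisymm ?_ ?_⟩
  · exact opNorm_le_of_dual norm_toDual_apply (toDual_adjointOperator Q)
  · exact opNorm_le_of_dual norm_toDual_flip_apply hflip
  · exact spectralRadius_le_of_dual norm_toDual_apply (toDual_adjointOperator Q)
  · exact spectralRadius_le_of_dual norm_toDual_flip_apply hflip
  · exact essentialSpectralRadius_le_of_dual norm_toDual_apply (toDual_adjointOperator Q)
  · exact essentialSpectralRadius_le_of_dual norm_toDual_flip_apply hflip
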